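/- Let $(\mathbf{B},\|\cdot\|)$ be a real separable Banach space with its Borel $\sigma$-algebra, and let $X, X_1, X_2, \dots$ be $\mathbf{B}$-valued random variables (Borel measurable maps) on a probability space $(\Omega,\mathcal{F},\mathbb{P})$ such that $\{X_n;\, n\ge 1\}$ is a sequence of independent random variables, each with the same distribution as $X$. Let $\{X_n';\, n\ge 1\}$ be an independent copy of $\{X_n;\, n\ge 1\}$, that is, a sequence of $\mathbf{B}$-valued random variables on the same probability space which, as a sequence, is independent of $\{X_n;\, n\ge 1\}$ and has the same distribution. Write $S_n=\sum_{i=1}^n X_i$ and $S_n'=\sum_{i=1}^n X_i'$, $n\ge 1$. Let $\{a_n;\, n\ge 1\}$ be a nondecreasing sequence of positive real numbers with $\lim_{n\to\infty}a_n=\infty$. Then \[ \frac{S_n-n\,\mathbb{E}\left(X I\{\|X\|\le a_n\}\right)}{a_n}\to 0 \ \text{ almost surely} \quad\text{if and only if}\quad \frac{S_n-S_n'}{a_n}\to 0\ \text{ almost surely}, \] and \[ \frac{S_n-n\,\mathbb{E}\left(X I\{\|X\|\le a_n\}\right)}{a_n}\to 0 \ \text{ in probability} \quad\text{if and only if}\quad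 \frac{S_n-S_n'}{a_n}\to 0\ \text{ in probability}. \] Here $I\{\cdot\}$ denotes the indicator function and the expectation of a $\mathbf{B}$-valued random variable is its Bochner integral. -/

import Mathlib

open MeasureTheory ProbabilityTheory Filter Topology

/-! ### Independence of paired sequences and of disjoint blocks. -/

section Independence

variable {Ω : Type*} [MeasurableSpace Ω] {P : Measure Ω}

/-! The forward directions hold because `Xs'` has the law of `Xs`: both sums obey the same limit,
and subtracting cancels the centring.

For the converse in probability, Fubini provides for each `n` a deterministic `b` such that S_n - b
is no more dispersed than S_n - S_n'. It remains to see that `b` is close to the truncated mean. The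
maximal inequality for symmetric sums and independence give n P(‖X‖ > η a_n) → 0, so truncating at r
= η a_n changes the sum only with small probability. Apply a functional norming the difference
between `b` and the truncated mean. The symmetrized truncated terms are then real, bounded and
symmetric, with a sum that is small in probability, and E cos of the sum bounds their total variance
by O(r²). Chebyshev puts the image of S_n within O(r) of that of the truncated mean; it is also near
that of `b`, so the two centrings differ by O(r) (`norm_sub_smul_truncated_mean_le`). Passing from
truncation at η a_n to a_n costs at most another η a_n.

For the almost sure converse, Fubini on path space freezes S_n' at a fixed path, giving a
deterministic centring that works almost surely. The result in probability shows that it is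
equivalent to the truncated mean. -/

/-- Pairing the terms of two independent families, each made of independent variables, gives a
family of independent variables. -/
theorem ProbabilityTheory.iIndepFun.prodMk_of_indepFun [IsProbabilityMeasure P]
    {α β : Type*} [MeasurableSpace α] [MeasurableSpace β]
    {X : ℕ → Ω → α} {Y : ℕ → Ω → β} (hX : iIndepFun X P) (hY : iIndepFun Y P)
    (hXm : ∀ i, Measurable (X i)) (hYm : ∀ i, Measurable (Y i))
    (hXY : IndepFun (fun ω i => X i ω) (fun ω i => Y i ω) P) :
    iIndepFun (fun i ω => (X i ω, Y i ω)) P := by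
  rw [iIndepFun_iff_iIndep]
  -- Measurable rectangles form a generating π-system, so the product formula need only be checked
  -- on them.
  refine iIndepSets.iIndep (fun i => ((hXm i).prodMk (hYm i)).comap_le)
    (fun i => Set.preimage (fun ω => (X i ω, Y i ω)) ''
      (Set.image2 (· ×ˢ ·) {s : Set α | MeasurableSet s} {t : Set β | MeasurableSet t}))
    (fun i => isPiSystem_prod.comap _) (fun i => ?_) ?_
  · rw [← generateFrom_prod, MeasurableSpace.comap_generateFrom]
  · rw [iIndepSets_iff]
    intro s f hf
    have hf' : ∀ i ∈ s, ∃ u : Set α, ∃ v : Set β, MeasurableSet u ∧ MeasurableSet v ∧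
        f i = X i ⁻¹' u ∩ Y i ⁻¹' v := by
      intro i hi
      obtain ⟨_, ⟨u, hu, v, hv, rfl⟩, h⟩ := hf i hi
      exact ⟨u, v, hu, hv, by rw [← h]; rfl⟩
    choose! u v hu hv huv using hf'
    have hU : MeasurableSet {x : ℕ → α | ∀ i ∈ s, x i ∈ u i} := by
      have : {x : ℕ → α | ∀ i ∈ s, x i ∈ u i} = ⋂ i ∈ s, (fun x : ℕ → α => x i) ⁻¹' (u i) := by
        ext; simp
      rw [this]
      exact Finset.measurableSet_biInter _ fun i hi => measurable_pi_apply i (hu i hi)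
    have hV : MeasurableSet {x : ℕ → β | ∀ i ∈ s, x i ∈ v i} := by
      have : {x : ℕ → β | ∀ i ∈ s, x i ∈ v i} = ⋂ i ∈ s, (fun x : ℕ → β => x i) ⁻¹' (v i) := by
        ext; simp
      rw [this]
      exact Finset.measurableSet_biInter _ fun i hi => measurable_pi_apply i (hv i hi)
    have h1 : (⋂ i ∈ s, f i) = (fun ω i => X i ω) ⁻¹' {x : ℕ → α | ∀ i ∈ s, x i ∈ u i} ∩
        (fun ω i => Y i ω) ⁻¹' {x : ℕ → β | ∀ i ∈ s, x i ∈ v i} := by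
      ext ω
      simp only [Set.mem_iInter, Set.mem_inter_iff, Set.mem_preimage, Set.mem_ofPred_eq]
      constructor
      · intro h
        exact ⟨fun i hi => (huv i hi ▸ h i hi).1, fun i hi => (huv i hi ▸ h i hi).2⟩
      · intro h i hi
        rw [huv i hi]
        exact ⟨h.1 i hi, h.2 i hi⟩
    have h2 : (fun ω i => X i ω) ⁻¹' {x : ℕ → α | ∀ i ∈ s, x i ∈ u i} =
        ⋂ i ∈ s, X i ⁻¹' (u i) := by ext; simp
    have h3 : (fun ω i => Y i ω) ⁻¹' {x : ℕ → β | ∀ i ∈ s, x i ∈ v i} =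
        ⋂ i ∈ s, Y i ⁻¹' (v i) := by ext; simp
    have hpair : ∀ i ∈ s, P (f i) = P (X i ⁻¹' u i) * P (Y i ⁻¹' v i) := by
      intro i hi
      rw [huv i hi]
      exact (hXY.comp (measurable_pi_apply i) (measurable_pi_apply i)).measure_inter_preimage_eq_mul
        _ _ (hu i hi) (hv i hi)
    rw [h1, hXY.measure_inter_preimage_eq_mul _ _ hU hV, h2, h3,
      hX.measure_inter_preimage_eq_mul s hu, hY.measure_inter_preimage_eq_mul s hv,
      ← Finset.prod_mul_distrib]
    exact (Finset.prod_congr rfl hpair).symm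

/-- Extending each block by zero keeps both on the path space `ℕ → α`, where functionals of the
whole sequence apply without subtypes. -/
theorem ProbabilityTheory.iIndepFun.indepFun_ite {α : Type*} [MeasurableSpace α] [Zero α]
    {D : ℕ → Ω → α} (hD : iIndepFun D P) (hDm : ∀ i, Measurable (D i)) {S T : Finset ℕ}
    (hST : Disjoint S T) :
    IndepFun (fun ω i => if i ∈ S then D i ω else 0) (fun ω i => if i ∈ T then D i ω else 0) P := by
  have key : ∀ S : Finset ℕ,
      Measurable fun (v : S → α) (i : ℕ) => if h : i ∈ S then v ⟨i, h⟩ else 0 := by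
    intro S
    refine measurable_pi_lambda _ fun i => ?_
    by_cases h : i ∈ S
    · simpa [h] using measurable_pi_apply _
    · simp [h]
  have := (hD.indepFun_finset S T hST hDm).comp (key S) (key T)
  convert this using 1 <;> · ext ω i; simp

/-- Independence is a property of the joint law: it is the product of its marginals. -/
theorem ProbabilityTheory.IdentDistrib.iIndepFun_of_process [IsProbabilityMeasure P]
    {α : Type*} [MeasurableSpace α] {X Y : ℕ → Ω → α} (hX : iIndepFun X P)
    (hXm : ∀ i, Measurable (X i)) (hYm : ∀ i, Measurable (Y i))
    (h : IdentDistrib (fun ω i => Y i ω) (fun ω i => X i ω) P P) : iIndepFun Y P := by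
  rw [iIndepFun_iff_map_fun_eq_infinitePi_map hYm, h.map_eq, hX.map_fun_eq_infinitePi_map hXm]
  congr 1
  ext1 i
  exact ((h.comp (measurable_pi_apply i)).map_eq).symm

end Independence

/-! ### Maximal inequality for symmetric sums. -/

section Symmetric

variable {Ω : Type*} [MeasurableSpace Ω] {P : Measure Ω} [IsProbabilityMeasure P]
  {B : Type*} [NormedAddCommGroup B] [MeasurableSpace B] [BorelSpace B]
  [SecondCountableTopology B]

theorem ProbabilityTheory.iIndepFun.identDistrib_neg_sum {D : ℕ → Ω → B} (hD : iIndepFun D P)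
    (hDm : ∀ i, Measurable (D i)) (hsymm : ∀ i, IdentDistrib (D i) (fun ω => -D i ω) P P)
    (s : Finset ℕ) :
    IdentDistrib (fun ω => ∑ i ∈ s, D i ω) (fun ω => -∑ i ∈ s, D i ω) P P := by
  induction s using Finset.induction_on with
  | empty => simpa using IdentDistrib.refl aemeasurable_const
  | insert k s hk ih =>
    have hind : IndepFun (fun ω => ∑ i ∈ s, D i ω) (D k) P := by
      have := hD.indepFun_finsetSum_of_notMem hDm hk
      convert this using 1
      ext ω; simp
    have h := (IdentDistrib.prodMk ih (hsymm k) hind (hind.comp measurable_neg measurable_neg)).comp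
      (measurable_fst.add measurable_snd)
    convert h using 1
    · ext ω; simp [Finset.sum_insert hk, add_comm]
    · ext ω; simp [Finset.sum_insert hk]

variable [NormedSpace ℝ B]

/-- The pairs (U, W) and (-U, W) have the same law, and 2W = (U + W) + (-U + W), so one of the
summands exceeds `t` when `W` does. -/
theorem measureReal_norm_gt_le_two_mul_of_symmetric {U W : Ω → B}
    (hW : Measurable W) (hUW : IndepFun U W P) (hsymm : IdentDistrib U (fun ω => -U ω) P P)
    (t : ℝ) : P.real {ω | t < ‖W ω‖} ≤ 2 * P.real {ω | t < ‖U ω + W ω‖} := by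
  have hpair : IdentDistrib (fun ω => (U ω, W ω)) (fun ω => (-U ω, W ω)) P P :=
    IdentDistrib.prodMk hsymm (IdentDistrib.refl hW.aemeasurable) hUW
      (hUW.comp measurable_neg measurable_id)
  have heq : P.real {ω | t < ‖U ω + W ω‖} = P.real {ω | t < ‖-U ω + W ω‖} := by
    have hs : MeasurableSet {x : B × B | t < ‖x.1 + x.2‖} :=
      measurableSet_lt measurable_const (by fun_prop)
    exact congrArg ENNReal.toReal (hpair.measure_mem_eq hs)
  have hsub : {ω | t < ‖W ω‖} ⊆ {ω | t < ‖U ω + W ω‖} ∪ {ω | t < ‖-U ω + W ω‖} := by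
    intro ω hω
    simp only [Set.mem_ofPred_eq, Set.mem_union] at hω ⊢
    by_contra! h
    have h2 := norm_add_le (U ω + W ω) (-U ω + W ω)
    rw [show U ω + W ω + (-U ω + W ω) = (2 : ℝ) • W ω by rw [two_smul]; abel, norm_smul] at h2
    norm_num at h2
    linarith
  calc _ ≤ _ := measureReal_mono hsub
    _ ≤ _ := measureReal_union_le _ _
    _ = _ := by rw [← heq]; ring

/-- Ottaviani's maximal inequality for sums of independent symmetric variables. -/
theorem ProbabilityTheory.iIndepFun.measureReal_exists_norm_sum_gt {D : ℕ → Ω → B}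
    (hD : iIndepFun D P) (hDm : ∀ i, Measurable (D i))
    (hsymm : ∀ i, IdentDistrib (D i) (fun ω => -D i ω) P P) (n : ℕ) (t : ℝ) :
    (1 - 2 * P.real {ω | t < ‖∑ i ∈ Finset.range n, D i ω‖}) *
      P.real {ω | ∃ k ≤ n, 2 * t < ‖∑ i ∈ Finset.range k, D i ω‖} ≤
    P.real {ω | t < ‖∑ i ∈ Finset.range n, D i ω‖} := by
  set p := P.real {ω | t < ‖∑ i ∈ Finset.range n, D i ω‖} with hp
  -- Paths whose partial sums first exceed 2t at time `k`.
  let C : ℕ → Set (ℕ → B) := fun k => {x | 2 * t < ‖∑ i ∈ Finset.range k, x i‖ ∧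
    ∀ j ∈ Finset.range k, ‖∑ i ∈ Finset.range j, x i‖ ≤ 2 * t}
  have hCm : ∀ k, MeasurableSet (C k) := by
    intro k
    have hlt : MeasurableSet {x : ℕ → B | 2 * t < ‖∑ i ∈ Finset.range k, x i‖} :=
      measurableSet_lt measurable_const (by fun_prop)
    refine hlt.inter ?_
    have : {x : ℕ → B | ∀ j ∈ Finset.range k, ‖∑ i ∈ Finset.range j, x i‖ ≤ 2 * t} =
        ⋂ j ∈ Finset.range k, {x : ℕ → B | ‖∑ i ∈ Finset.range j, x i‖ ≤ 2 * t} := by ext; simp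
    change MeasurableSet {x : ℕ → B | ∀ j ∈ Finset.range k, ‖∑ i ∈ Finset.range j, x i‖ ≤ 2 * t}
    rw [this]
    exact Finset.measurableSet_biInter _ fun j _ =>
      measurableSet_le (by fun_prop) measurable_const
  let A : ℕ → Set Ω := fun k => {ω | (fun i => D i ω) ∈ C k}
  have hDp : Measurable fun ω i => D i ω := measurable_pi_lambda _ hDm
  have hAm : ∀ k, MeasurableSet (A k) := fun k => hDp (hCm k)
  have hdisj : Set.PairwiseDisjoint (↑(Finset.range (n + 1))) A := by
    have : ∀ j k, j < k → Disjoint (A j) (A k) := by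
      intro j k hjk
      rw [Set.disjoint_left]
      intro ω hj hk
      exact absurd hj.1 (not_lt.mpr (hk.2 j (Finset.mem_range.mpr hjk)))
    intro j _ k _ hjk
    rcases lt_or_gt_of_ne hjk with h | h
    · exact this j k h
    · exact (this k j h).symm
  -- After a first passage at `k`, the final sum still exceeds `t` unless the increment from `k` to
  -- `n` does; that increment is independent of `A k`.
  have hstep : ∀ k ∈ Finset.range (n + 1), P.real (A k) * (1 - 2 * p) ≤
      P.real (A k ∩ {ω | t < ‖∑ i ∈ Finset.range n, D i ω‖}) := by
    intro k hk
    have hkn : k ≤ n := Nat.lt_succ_iff.mp (Finset.mem_range.mp hk)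
    have hST : Disjoint (Finset.range k) (Finset.Ico k n) := by
      rw [Finset.disjoint_left]
      intro i hi hi'
      simp only [Finset.mem_range, Finset.mem_Ico] at hi hi'
      omega
    have hind := hD.indepFun_ite hDm hST
    have hsumk : ∀ ω, ∀ j ≤ k, ∑ i ∈ Finset.range j,
        (if i ∈ Finset.range k then D i ω else 0) = ∑ i ∈ Finset.range j, D i ω := by
      intro ω j hj
      refine Finset.sum_congr rfl fun i hi => if_pos ?_
      rw [Finset.mem_range] at hi ⊢; omega
    have hsumI : ∀ ω, ∑ i ∈ Finset.Ico k n,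
        (if i ∈ Finset.Ico k n then D i ω else 0) = ∑ i ∈ Finset.Ico k n, D i ω :=
      fun ω => Finset.sum_congr rfl fun i hi => if_pos hi
    have htail : P.real {ω | t < ‖∑ i ∈ Finset.Ico k n, D i ω‖} ≤ 2 * p := by
      have hUW : IndepFun (fun ω => ∑ i ∈ Finset.range k, D i ω)
          (fun ω => ∑ i ∈ Finset.Ico k n, D i ω) P := by
        have := hind.comp (φ := fun x => ∑ i ∈ Finset.range k, x i)
          (ψ := fun x => ∑ i ∈ Finset.Ico k n, x i) (by fun_prop) (by fun_prop)
        convert this using 1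
        · ext ω; exact (hsumk ω k le_rfl).symm
        · ext ω; exact (hsumI ω).symm
      have := measureReal_norm_gt_le_two_mul_of_symmetric (by fun_prop) hUW
        (hD.identDistrib_neg_sum hDm hsymm _) t
      simpa only [Finset.sum_range_add_sum_Ico _ hkn] using this
    have hT : MeasurableSet {x : ℕ → B | ‖∑ i ∈ Finset.Ico k n, x i‖ ≤ t} :=
      measurableSet_le (by fun_prop) measurable_const
    have hprod := hind.measure_inter_preimage_eq_mul _ _ (hCm k) hT
    have hA : (fun ω i => if i ∈ Finset.range k then D i ω else 0) ⁻¹' C k = A k := by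
      ext ω
      simp only [C, A, Set.mem_preimage, Set.mem_ofPred_eq, hsumk ω k le_rfl]
      refine and_congr_right fun _ => forall₂_congr fun j hj => ?_
      rw [hsumk ω j (Finset.mem_range.mp hj).le]
    have hT' : (fun ω i => if i ∈ Finset.Ico k n then D i ω else 0) ⁻¹'
        {x : ℕ → B | ‖∑ i ∈ Finset.Ico k n, x i‖ ≤ t} =
        {ω | ‖∑ i ∈ Finset.Ico k n, D i ω‖ ≤ t} := by
      ext ω
      simp only [Set.mem_preimage, Set.mem_ofPred_eq, hsumI]
    rw [hA, hT'] at hprod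
    have hcompl : P.real {ω | ‖∑ i ∈ Finset.Ico k n, D i ω‖ ≤ t} =
        1 - P.real {ω | t < ‖∑ i ∈ Finset.Ico k n, D i ω‖} := by
      rw [← probReal_compl_eq_one_sub (measurableSet_lt measurable_const (by fun_prop))]
      congr 1
      ext ω; simp
    calc P.real (A k) * (1 - 2 * p)
        ≤ P.real (A k) * P.real {ω | ‖∑ i ∈ Finset.Ico k n, D i ω‖ ≤ t} := by
          rw [hcompl]; gcongr
      _ = P.real (A k ∩ {ω | ‖∑ i ∈ Finset.Ico k n, D i ω‖ ≤ t}) := by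
          simp only [measureReal_def, hprod, ENNReal.toReal_mul]
      _ ≤ _ := by
          refine measureReal_mono fun ω hω => ⟨hω.1, ?_⟩
          have h1 : 2 * t < ‖∑ i ∈ Finset.range k, D i ω‖ := hω.1.1
          have h2 : ‖∑ i ∈ Finset.Ico k n, D i ω‖ ≤ t := hω.2
          have h3 := norm_sub_le (∑ i ∈ Finset.range n, D i ω) (∑ i ∈ Finset.Ico k n, D i ω)
          rw [← Finset.sum_range_add_sum_Ico _ hkn, add_sub_cancel_right,
            Finset.sum_range_add_sum_Ico _ hkn] at h3
          change t < _
          linarith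
  have hunion : P.real {ω | ∃ k ≤ n, 2 * t < ‖∑ i ∈ Finset.range k, D i ω‖} ≤
      ∑ k ∈ Finset.range (n + 1), P.real (A k) := by
    refine le_trans (measureReal_mono ?_ (measure_ne_top _ _)) (measureReal_biUnion_finset_le _ _)
    rintro ω ⟨k, hk, hkt⟩
    classical
    have hex : ∃ k, 2 * t < ‖∑ i ∈ Finset.range k, D i ω‖ := ⟨k, hkt⟩
    simp only [Set.mem_iUnion]
    refine ⟨Nat.find hex, Finset.mem_range.mpr ?_, Nat.find_spec hex, fun j hj => ?_⟩
    · exact Nat.lt_succ_of_le ((Nat.find_min' hex hkt).trans hk)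
    · exact not_lt.mp (Nat.find_min hex (Finset.mem_range.mp hj))
  by_cases hneg : 1 - 2 * p ≤ 0
  · exact (mul_nonpos_of_nonpos_of_nonneg hneg measureReal_nonneg).trans measureReal_nonneg
  push Not at hneg
  calc _ ≤ (1 - 2 * p) * ∑ k ∈ Finset.range (n + 1), P.real (A k) := by gcongr
    _ = ∑ k ∈ Finset.range (n + 1), P.real (A k) * (1 - 2 * p) := by
        rw [mul_comm, Finset.sum_mul]
    _ ≤ ∑ k ∈ Finset.range (n + 1), P.real (A k ∩ {ω | t < ‖∑ i ∈ Finset.range n, D i ω‖}) :=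
        Finset.sum_le_sum hstep
    _ = P.real (⋃ k ∈ Finset.range (n + 1), A k ∩ {ω | t < ‖∑ i ∈ Finset.range n, D i ω‖}) := by
        rw [measureReal_biUnion_finset]
        · exact hdisj.mono fun k => Set.inter_subset_left
        · intro k _
          exact (hAm k).inter (measurableSet_lt measurable_const (by fun_prop))
    _ ≤ p := measureReal_mono (Set.iUnion₂_subset fun k _ => Set.inter_subset_right)

end Symmetric

/-! ### From the tail of a sum to the tail of one term. -/

section Tails

variable {Ω : Type*} [MeasurableSpace Ω] {P : Measure Ω} [IsProbabilityMeasure P]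
  {B : Type*} [NormedAddCommGroup B] [MeasurableSpace B] [BorelSpace B]

/-- If `X` exceeds 2t while its independent copy stays below `t`, the difference exceeds `t`. -/
theorem measureReal_norm_gt_mul_le_sub {X X' : Ω → B} (hind : IndepFun X X' P)
    (hid : IdentDistrib X' X P P) (t : ℝ) :
    P.real {ω | 2 * t < ‖X ω‖} * P.real {ω | ‖X ω‖ ≤ t} ≤ P.real {ω | t < ‖X ω - X' ω‖} := by
  have h1 : MeasurableSet {x : B | 2 * t < ‖x‖} := measurableSet_lt measurable_const (by fun_prop)
  have h2 : MeasurableSet {x : B | ‖x‖ ≤ t} := measurableSet_le (by fun_prop) measurable_const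
  have hprod := hind.measure_inter_preimage_eq_mul _ _ h1 h2
  rw [hid.measure_mem_eq h2] at hprod
  have := congrArg ENNReal.toReal hprod
  rw [ENNReal.toReal_mul] at this
  refine this.symm.le.trans (measureReal_mono ?_)
  rintro ω ⟨ha, hb⟩
  simp only [Set.mem_preimage, Set.mem_ofPred_eq] at ha hb ⊢
  linarith [norm_le_norm_sub_add (X ω) (X' ω)]

variable [NormedSpace ℝ B] [SecondCountableTopology B]

/-- A term is the difference of two consecutive partial sums, so a term above 4t forces a partial
sum above 2t, which the maximal inequality makes unlikely. By independence this reads 1 - 2p ≤ (1 -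
q)^n ≤ exp(-nq), hence nq ≤ 2p / (1 - 2p) ≤ 4p. -/
theorem mul_measureReal_norm_gt_le_of_symmetric {D : ℕ → Ω → B}
    (hD : iIndepFun D P) (hDm : ∀ i, Measurable (D i))
    (hsymm : ∀ i, IdentDistrib (D i) (fun ω => -D i ω) P P)
    {Z : Ω → B} (hid : ∀ i, IdentDistrib (D i) Z P P) (n : ℕ) (t : ℝ)
    (hp : P.real {ω | t < ‖∑ i ∈ Finset.range n, D i ω‖} ≤ 1 / 4) :
    n * P.real {ω | 4 * t < ‖Z ω‖} ≤ 4 * P.real {ω | t < ‖∑ i ∈ Finset.range n, D i ω‖} := by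
  have hmax := hD.measureReal_exists_norm_sum_gt hDm hsymm n t
  set p := P.real {ω | t < ‖∑ i ∈ Finset.range n, D i ω‖} with hpdef
  set m := P.real {ω | ∃ k ≤ n, 2 * t < ‖∑ i ∈ Finset.range k, D i ω‖}
  set q := P.real {ω | 4 * t < ‖Z ω‖} with hq
  have hp0 : 0 ≤ p := measureReal_nonneg
  have hm0 : 0 ≤ m := measureReal_nonneg
  have hm : m ≤ 2 * p := by nlinarith
  have hball : MeasurableSet {x : B | ‖x‖ ≤ 4 * t} :=
    measurableSet_le (by fun_prop) measurable_const
  have hone : ∀ i, P.real (D i ⁻¹' {x : B | ‖x‖ ≤ 4 * t}) = 1 - q := by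
    intro i
    rw [hq, ← show P.real {ω | 4 * t < ‖D i ω‖} = P.real {ω | 4 * t < ‖Z ω‖} from
      congrArg ENNReal.toReal ((hid i).measure_mem_eq (s := {x : B | 4 * t < ‖x‖})
        (measurableSet_lt measurable_const (by fun_prop))),
      ← probReal_compl_eq_one_sub (measurableSet_lt measurable_const (by fun_prop))]
    congr 1
    ext ω; simp
  have hpow : P.real (⋂ i ∈ Finset.range n, D i ⁻¹' {x : B | ‖x‖ ≤ 4 * t}) = (1 - q) ^ n := by
    rw [measureReal_def, hD.measure_inter_preimage_eq_mul _ fun _ _ => hball, ENNReal.toReal_prod]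
    refine (Finset.prod_congr rfl fun i _ => hone i).trans ?_
    simp
  have hcover : (⋂ i ∈ Finset.range n, D i ⁻¹' {x : B | ‖x‖ ≤ 4 * t})ᶜ ⊆
      {ω | ∃ k ≤ n, 2 * t < ‖∑ i ∈ Finset.range k, D i ω‖} := by
    intro ω hω
    simp only [Set.mem_compl_iff, Set.mem_iInter, Finset.mem_range, Set.mem_preimage,
      Set.mem_ofPred_eq, not_forall, not_le] at hω
    obtain ⟨i, hi, hiω⟩ := hω
    by_contra! hcon
    simp only [Set.mem_ofPred_eq, not_exists, not_and, not_lt] at hcon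
    have h1 := hcon (i + 1) hi
    have h2 := hcon i hi.le
    have h3 := norm_sub_le (∑ j ∈ Finset.range (i + 1), D j ω) (∑ j ∈ Finset.range i, D j ω)
    rw [Finset.sum_range_succ_sub_sum] at h3
    linarith
  have hlow : 1 - 2 * p ≤ (1 - q) ^ n := by
    have h1 := measureReal_mono (μ := P) hcover
    rw [probReal_compl_eq_one_sub (Finset.measurableSet_biInter _ fun i _ => hDm i hball),
      hpow] at h1
    change 1 - (1 - q) ^ n ≤ m at h1
    linarith
  have hq1 : q ≤ 1 := measureReal_le_one
  have hexp : (1 - q) ^ n ≤ Real.exp (-(n * q)) := by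
    calc (1 - q) ^ n ≤ (Real.exp (-q)) ^ n := by
          refine pow_le_pow_left₀ (by linarith) (Real.one_sub_le_exp_neg q) n
      _ = _ := by rw [← Real.exp_nat_mul]; ring_nf
  have hx0 : 0 ≤ n * q := mul_nonneg (Nat.cast_nonneg n) measureReal_nonneg
  have hprod : (1 - 2 * p) * (1 + n * q) ≤ 1 := by
    calc (1 - 2 * p) * (1 + n * q) ≤ Real.exp (-(n * q)) * Real.exp (n * q) := by
          refine mul_le_mul (hlow.trans hexp) ?_ (by linarith) (Real.exp_pos _).le
          linarith [Real.add_one_le_exp (n * q)]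
      _ = 1 := by rw [← Real.exp_add]; simp
  nlinarith

end Tails

/-! ### Variance bound from characteristic functions. -/

section RealSums

variable {Ω : Type*} [MeasurableSpace Ω] {P : Measure Ω}

theorem integral_sin_eq_zero_of_symmetric {ξ : Ω → ℝ}
    (hsymm : IdentDistrib ξ (fun ω => -ξ ω) P P) : ∫ ω, Real.sin (ξ ω) ∂P = 0 := by
  have h := (hsymm.comp Real.measurable_sin).integral_eq
  simp only [Function.comp_def, Real.sin_neg, integral_neg] at h
  linarith

variable [IsProbabilityMeasure P]

theorem integrable_cos_comp {V : Ω → ℝ} (hV : Measurable V) :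
    Integrable (fun ω => Real.cos (V ω)) P :=
  Integrable.of_bound (by fun_prop) 1 (ae_of_all _ fun ω => by simpa using Real.abs_cos_le_one _)

theorem integrable_sin_comp {V : Ω → ℝ} (hV : Measurable V) :
    Integrable (fun ω => Real.sin (V ω)) P :=
  Integrable.of_bound (by fun_prop) 1 (ae_of_all _ fun ω => by simpa using Real.abs_sin_le_one _)

/-- Characteristic functions multiply, and symmetry kills the sine terms. -/
theorem ProbabilityTheory.iIndepFun.integral_cos_sum {ξ : ℕ → Ω → ℝ} (hξ : iIndepFun ξ P)
    (hξm : ∀ i, Measurable (ξ i)) (hsymm : ∀ i, IdentDistrib (ξ i) (fun ω => -ξ i ω) P P)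
    (n : ℕ) : ∫ ω, Real.cos (∑ i ∈ Finset.range n, ξ i ω) ∂P =
      ∏ i ∈ Finset.range n, ∫ ω, Real.cos (ξ i ω) ∂P := by
  induction n with
  | zero => simp
  | succ n ih =>
    have hind : IndepFun (fun ω => ∑ i ∈ Finset.range n, ξ i ω) (ξ n) P := by
      have := hξ.indepFun_finsetSum_of_notMem hξm (Finset.notMem_range_self (n := n))
      convert this using 1
      ext ω; simp
    have hc := (hind.comp Real.measurable_cos Real.measurable_cos).integral_fun_mul_eq_mul_integral
      (by fun_prop) (by fun_prop)
    have hs := (hind.comp Real.measurable_sin Real.measurable_sin).integral_fun_mul_eq_mul_integral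
      (by fun_prop) (by fun_prop)
    simp only [Function.comp_def] at hc hs
    rw [integral_sin_eq_zero_of_symmetric (hsymm n), mul_zero] at hs
    simp only [Finset.sum_range_succ, Finset.prod_range_succ, Real.cos_add]
    rw [integral_sub, hc, hs, ih, sub_zero]
    · exact (hind.comp Real.measurable_cos Real.measurable_cos).integrable_mul
        (integrable_cos_comp (by fun_prop)) (integrable_cos_comp (hξm n))
    · exact (hind.comp Real.measurable_sin Real.measurable_sin).integrable_mul
        (integrable_sin_comp (by fun_prop)) (integrable_sin_comp (hξm n))

/-- If a sum of independent symmetric variables bounded by `1` is small with large probability,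
then its variance is at most an absolute constant. -/
theorem ProbabilityTheory.iIndepFun.sum_integral_sq_le {ξ : ℕ → Ω → ℝ} (hξ : iIndepFun ξ P)
    (hξm : ∀ i, Measurable (ξ i)) (hsymm : ∀ i, IdentDistrib (ξ i) (fun ω => -ξ i ω) P P)
    (hbdd : ∀ i ω, |ξ i ω| ≤ 1) (n : ℕ)
    (hsmall : P.real {ω | 1 / 10 < |∑ i ∈ Finset.range n, ξ i ω|} ≤ 1 / 10) :
    ∑ i ∈ Finset.range n, ∫ ω, ξ i ω ^ 2 ∂P ≤ 5 / 2 := by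
  -- The constant 1/5 is below 2/π², since π² < 10.
  have hcos : ∀ x : ℝ, |x| ≤ 1 → Real.cos x ≤ 1 - 1 / 5 * x ^ 2 := by
    intro x hx
    have h1 := Real.cos_le_one_sub_mul_cos_sq (x := x) (by linarith [Real.pi_gt_three])
    have h2 : (1 / 5 : ℝ) ≤ 2 / Real.pi ^ 2 := by
      rw [le_div_iff₀ (by positivity)]
      nlinarith [Real.pi_lt_d2, Real.pi_pos]
    nlinarith [sq_nonneg x]
  have hint : ∀ i, Integrable (fun ω => ξ i ω ^ 2) P := fun i =>
    Integrable.of_bound (by fun_prop) 1 (ae_of_all _ fun ω => by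
      simpa using pow_le_one₀ (n := 2) (abs_nonneg _) (hbdd i ω))
  have hfac : ∀ i, ∫ ω, Real.cos (ξ i ω) ∂P ≤ Real.exp (-(1 / 5 * ∫ ω, ξ i ω ^ 2 ∂P)) := by
    intro i
    refine le_trans ?_ (Real.one_sub_le_exp_neg _)
    calc ∫ ω, Real.cos (ξ i ω) ∂P ≤ ∫ ω, (1 - 1 / 5 * ξ i ω ^ 2) ∂P :=
          integral_mono (integrable_cos_comp (hξm i))
            ((integrable_const _).sub ((hint i).const_mul _)) fun ω => hcos _ (hbdd i ω)
      _ = _ := by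
          rw [integral_sub (integrable_const _) ((hint i).const_mul _), integral_const_mul]
          simp
  have hnonneg : ∀ i, 0 ≤ ∫ ω, Real.cos (ξ i ω) ∂P := fun i =>
    integral_nonneg fun ω => Real.cos_nonneg_of_mem_Icc <| by
      have := abs_le.mp (hbdd i ω)
      constructor <;> linarith [Real.pi_gt_three]
  have hupper : ∫ ω, Real.cos (∑ i ∈ Finset.range n, ξ i ω) ∂P ≤
      Real.exp (-(1 / 5 * ∑ i ∈ Finset.range n, ∫ ω, ξ i ω ^ 2 ∂P)) := by
    rw [hξ.integral_cos_sum hξm hsymm, Finset.mul_sum, ← Finset.sum_neg_distrib, Real.exp_sum]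
    exact Finset.prod_le_prod (fun i _ => hnonneg i) fun i _ => hfac i
  have hVm : Measurable fun ω => ∑ i ∈ Finset.range n, ξ i ω := by fun_prop
  set E := {ω | 1 / 10 < |∑ i ∈ Finset.range n, ξ i ω|} with hE
  have hEm : MeasurableSet E := measurableSet_lt measurable_const (by fun_prop)
  have hlower : 1 - 1 / 200 - 2 * (1 / 10) ≤ ∫ ω, Real.cos (∑ i ∈ Finset.range n, ξ i ω) ∂P := by
    have hI : Integrable (E.indicator fun _ => (2 : ℝ)) P := (integrable_const _).indicator hEm
    calc (1 : ℝ) - 1 / 200 - 2 * (1 / 10) ≤ 1 - 1 / 200 - 2 * P.real E := by linarith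
      _ = ∫ ω, ((1 - 1 / 200) - E.indicator (fun _ => (2 : ℝ)) ω) ∂P := by
          rw [integral_sub (integrable_const _) hI, integral_indicator hEm]
          simp; ring
      _ ≤ _ := by
          refine integral_mono ((integrable_const _).sub hI) (integrable_cos_comp hVm) fun ω => ?_
          by_cases hω : ω ∈ E
          · simp only [Set.indicator_of_mem hω]
            linarith [Real.neg_one_le_cos (∑ i ∈ Finset.range n, ξ i ω)]
          · simp only [Set.indicator_of_notMem hω]
            have h1 : |∑ i ∈ Finset.range n, ξ i ω| ≤ 1 / 10 := not_lt.mp hω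
            have h2 := Real.one_sub_sq_div_two_le_cos (x := ∑ i ∈ Finset.range n, ξ i ω)
            have h3 : (∑ i ∈ Finset.range n, ξ i ω) ^ 2 ≤ (1 / 10) ^ 2 := by
              rw [← sq_abs]; gcongr
            linarith
  by_contra! hcon
  set σ := ∑ i ∈ Finset.range n, ∫ ω, ξ i ω ^ 2 ∂P
  have h1 : Real.exp (-(1 / 5 * σ)) * Real.exp (1 / 5 * σ) = 1 := by
    rw [← Real.exp_add]; simp
  have h2 := Real.add_one_le_exp (1 / 5 * σ)
  have h3 := hlower.trans hupper
  -- If σ > 5/2 then exp(-σ/5) < 2/3, below the lower bound 0.795.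
  nlinarith [Real.exp_pos (-(1 / 5 * σ))]

end RealSums

/-! ### Desymmetrization and location of the centring. -/

section Symmetrization

variable {Ω : Type*} [MeasurableSpace Ω] {P : Measure Ω}

/-- By Fubini the joint probability is the average over `V` of the section probabilities, so some
section is at most the average. -/
theorem exists_measure_section_le [IsProbabilityMeasure P] {α β : Type*} [MeasurableSpace α]
    [MeasurableSpace β] {U : Ω → α} {V : Ω → β} (hU : Measurable U) (hV : Measurable V)
    (hUV : IndepFun U V P) {s : Set (α × β)} (hs : MeasurableSet s) :
    ∃ y, P {ω | (U ω, y) ∈ s} ≤ P {ω | (U ω, V ω) ∈ s} := by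
  have hmap := (indepFun_iff_map_prod_eq_prod_map_map hU.aemeasurable hV.aemeasurable).mp hUV
  have : IsProbabilityMeasure (P.map V) := Measure.isProbabilityMeasure_map hV.aemeasurable
  have : IsProbabilityMeasure (P.map U) := Measure.isProbabilityMeasure_map hU.aemeasurable
  obtain ⟨y, hy⟩ := exists_le_lintegral (μ := P.map V)
    (f := fun y => P.map U ((fun x => (x, y)) ⁻¹' s))
    (measurable_measure_prodMk_right hs).aemeasurable
  refine ⟨y, ?_⟩
  rw [← Measure.prod_apply_symm hs, ← hmap, Measure.map_apply (hU.prodMk hV) hs,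
    Measure.map_apply hU (measurable_prodMk_right hs)] at hy
  exact hy

theorem identDistrib_sub_neg_sub [IsFiniteMeasure P] {E : Type*} [AddCommGroup E]
    [MeasurableSpace E] [MeasurableSub₂ E] {U V : Ω → E}
    (hUV : IndepFun U V P) (hid : IdentDistrib V U P P) :
    IdentDistrib (fun ω => U ω - V ω) (fun ω => -(U ω - V ω)) P P := by
  have h := (IdentDistrib.prodMk hid.symm hid hUV hUV.symm).comp
    (measurable_fst.sub measurable_snd)
  convert h using 1 <;> · ext ω; simp

theorem variance_le_integral_sub_sq [IsProbabilityMeasure P] {U V : Ω → ℝ} (hU : MemLp U 2 P)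
    (hV : MemLp V 2 P) (hUV : IndepFun U V P) :
    Var[U; P] ≤ ∫ ω, (U ω - V ω) ^ 2 ∂P := by
  have hneg : IndepFun U (-V) P := hUV.comp measurable_id measurable_neg
  have h1 := hneg.variance_add hU hV.neg
  have h2 := variance_le_expectation_sq (μ := P) (X := U + -V)
    (hU.add hV.neg).aestronglyMeasurable
  have h3 := variance_nonneg (-V) P
  have h4 : ∫ ω, ((U + -V) ^ 2) ω ∂P = ∫ ω, (U ω - V ω) ^ 2 ∂P := by
    simp [sub_eq_add_neg]
  linarith

variable {B : Type*} [NormedAddCommGroup B] [MeasurableSpace B] [BorelSpace B]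

theorem measureReal_exists_norm_gt_le {Y : ℕ → Ω → B} {X : Ω → B}
    (hid : ∀ i, IdentDistrib (Y i) X P P) (n : ℕ) (r : ℝ) :
    P.real {ω | ∃ i ∈ Finset.range n, r < ‖Y i ω‖} ≤ n * P.real {ω | r < ‖X ω‖} := by
  have h : {ω | ∃ i ∈ Finset.range n, r < ‖Y i ω‖} =
      ⋃ i ∈ Finset.range n, {ω | r < ‖Y i ω‖} := by ext; simp
  rw [h]
  refine (measureReal_biUnion_finset_le _ _).trans (le_of_eq ?_)
  rw [Finset.sum_congr rfl fun i _ => show P.real {ω | r < ‖Y i ω‖} = P.real {ω | r < ‖X ω‖} from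
      congrArg ENNReal.toReal ((hid i).measure_mem_eq (s := {x : B | r < ‖x‖})
        (measurableSet_lt measurable_const (by fun_prop)))]
  simp

variable [IsProbabilityMeasure P] [SecondCountableTopology B]

theorem integrable_indicator_norm_le {X : Ω → B} (hX : Measurable X) (r : ℝ) :
    Integrable ({x | ‖X x‖ ≤ r}.indicator X) P := by
  have hs : MeasurableSet {x | ‖X x‖ ≤ r} := measurableSet_le (by fun_prop) measurable_const
  refine Integrable.of_bound (hX.indicator hs).aestronglyMeasurable |r| (ae_of_all _ fun ω => ?_)
  by_cases hω : ω ∈ {x | ‖X x‖ ≤ r}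
  · rw [Set.indicator_of_mem hω]; exact le_trans hω (le_abs_self r)
  · rw [Set.indicator_of_notMem hω]; simp

variable [NormedSpace ℝ B]

/-- The two truncations differ only where r < ‖X‖ ≤ s, by a vector of norm at most `s`. -/
theorem norm_integral_indicator_sub_le {X : Ω → B} (hX : Measurable X) {r s : ℝ} (hrs : r ≤ s)
    (hs : 0 ≤ s) :
    ‖(∫ ω, {x | ‖X x‖ ≤ r}.indicator X ω ∂P) - ∫ ω, {x | ‖X x‖ ≤ s}.indicator X ω ∂P‖ ≤
      s * P.real {ω | r < ‖X ω‖} := by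
  have hm : MeasurableSet {ω | r < ‖X ω‖} := measurableSet_lt measurable_const (by fun_prop)
  rw [← integral_sub (integrable_indicator_norm_le hX r) (integrable_indicator_norm_le hX s)]
  calc _ ≤ ∫ ω, {ω | r < ‖X ω‖}.indicator (fun _ => s) ω ∂P := by
        refine norm_integral_le_of_norm_le ((integrable_const s).indicator hm)
          (ae_of_all _ fun ω => ?_)
        by_cases h1 : ‖X ω‖ ≤ r
        · rw [Set.indicator_of_mem (s := {x | ‖X x‖ ≤ r}) h1,
            Set.indicator_of_mem (s := {x | ‖X x‖ ≤ s}) (h1.trans hrs), sub_self, norm_zero]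
          exact Set.indicator_nonneg (fun _ _ => hs) _
        · rw [Set.indicator_of_notMem (s := {x | ‖X x‖ ≤ r}) h1, zero_sub, norm_neg,
            Set.indicator_of_mem (s := {ω | r < ‖X ω‖}) (not_le.mp h1)]
          by_cases h2 : ‖X ω‖ ≤ s
          · rw [Set.indicator_of_mem (s := {x | ‖X x‖ ≤ s}) h2]; exact h2
          · rw [Set.indicator_of_notMem (s := {x | ‖X x‖ ≤ s}) h2]; simpa using hs
    _ = _ := by rw [integral_indicator hm]; simp [mul_comm]

variable [CompleteSpace B]

/-- If the symmetrized sum is at most `r / 5` and all terms are at most `r` with large probability,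
then any point near which the sum concentrates at scale `r` is near the truncated mean. -/
theorem norm_sub_smul_truncated_mean_le {Xs Xs' : ℕ → Ω → B} {X : Ω → B} (hX : Measurable X)
    (hXs : ∀ i, Measurable (Xs i)) (hXs' : ∀ i, Measurable (Xs' i))
    (hpair : iIndepFun (fun i ω => (Xs i ω, Xs' i ω)) P)
    (hindep : ∀ i, IndepFun (Xs i) (Xs' i) P)
    (hid : ∀ i, IdentDistrib (Xs i) X P P) (hid' : ∀ i, IdentDistrib (Xs' i) X P P)
    {r : ℝ} (hr : 0 < r) (n : ℕ) (b : B)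
    (hsymm : P.real {ω | r / 5 < ‖∑ i ∈ Finset.range n, Xs i ω - ∑ i ∈ Finset.range n, Xs' i ω‖}
      ≤ 1 / 20)
    (htail : n * P.real {ω | r < ‖X ω‖} ≤ 1 / 100)
    (hb : P.real {ω | r < ‖∑ i ∈ Finset.range n, Xs i ω - b‖} ≤ 1 / 20) :
    ‖b - (n : ℝ) • ∫ ω, {x | ‖X x‖ ≤ r}.indicator X ω ∂P‖ ≤ 6 * r := by
  set m := (n : ℝ) • ∫ ω, {x | ‖X x‖ ≤ r}.indicator X ω ∂P with hm
  -- A norming functional reduces the claim to real variables; this form also covers b = m.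
  obtain ⟨f, hf1, hfx⟩ := exists_dual_vector'' ℝ (b - m)
  have hfle : ∀ x, |f x| ≤ ‖x‖ := fun x =>
    (f.le_of_opNorm_le hf1 x).trans (by rw [one_mul])
  let g : B → ℝ := fun x => f ({x | ‖x‖ ≤ r}.indicator id x)
  have hgm : Measurable g := f.continuous.measurable.comp
    (measurable_id.indicator (measurableSet_le (by fun_prop) measurable_const))
  have hgle : ∀ x, |g x| ≤ r := by
    intro x
    refine (hfle _).trans ?_
    by_cases hx : ‖x‖ ≤ r
    · rw [Set.indicator_of_mem (s := {x : B | ‖x‖ ≤ r}) hx]; exact hx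
    · rw [Set.indicator_of_notMem (s := {x : B | ‖x‖ ≤ r}) hx, norm_zero]; exact hr.le
  have hgeq : ∀ x, ‖x‖ ≤ r → g x = f x := fun x hx => by
    simp only [g]; rw [Set.indicator_of_mem (s := {x : B | ‖x‖ ≤ r}) hx]; rfl
  have hgL : ∀ (Y : Ω → B), Measurable Y → MemLp (fun ω => g (Y ω)) 2 P := fun Y hY =>
    MemLp.of_bound (hgm.comp hY).aestronglyMeasurable r (ae_of_all _ fun ω => hgle _)
  have hfm : f m = n * ∫ ω, g (X ω) ∂P := by
    rw [hm, map_smul, ← f.integral_comp_comm (integrable_indicator_norm_le hX r), smul_eq_mul]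
    congr 2
  -- Dividing by 2r bounds the terms by 1 and turns the threshold r/5 into 1/10.
  let ξ : ℕ → Ω → ℝ := fun i ω => (g (Xs i ω) - g (Xs' i ω)) / (2 * r)
  have hξm : ∀ i, Measurable (ξ i) := fun i =>
    ((hgm.comp (hXs i)).sub (hgm.comp (hXs' i))).div_const _
  have hξind : iIndepFun ξ P :=
    hpair.comp (fun _ p => (g p.1 - g p.2) / (2 * r)) fun _ => by fun_prop
  have hgi : ∀ i, IndepFun (fun ω => g (Xs i ω)) (fun ω => g (Xs' i ω)) P := fun i =>
    (hindep i).comp hgm hgm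
  have hξsymm : ∀ i, IdentDistrib (ξ i) (fun ω => -ξ i ω) P P := by
    intro i
    have h := (identDistrib_sub_neg_sub (hgi i)
      (((hid' i).trans (hid i).symm).comp hgm)).div_const (2 * r)
    convert h using 2
    simp only [ξ]; ring
  have hξb : ∀ i ω, |ξ i ω| ≤ 1 := by
    intro i ω
    simp only [ξ]
    rw [abs_div, abs_of_pos (by positivity : 0 < 2 * r), div_le_one (by positivity)]
    linarith [abs_sub (g (Xs i ω)) (g (Xs' i ω)), hgle (Xs i ω), hgle (Xs' i ω)]
  have hbig := measureReal_exists_norm_gt_le hid n r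
  have hbig' := measureReal_exists_norm_gt_le hid' n r
  have hsum : ∀ (Y : ℕ → Ω → B) (ω : Ω), (¬∃ i ∈ Finset.range n, r < ‖Y i ω‖) →
      ∑ i ∈ Finset.range n, g (Y i ω) = f (∑ i ∈ Finset.range n, Y i ω) := by
    intro Y ω h
    push Not at h
    rw [map_sum]
    exact Finset.sum_congr rfl fun i hi => hgeq _ (h i hi)
  have hsmall : P.real {ω | 1 / 10 < |∑ i ∈ Finset.range n, ξ i ω|} ≤ 1 / 10 := by
    have hsub : {ω | 1 / 10 < |∑ i ∈ Finset.range n, ξ i ω|} ⊆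
        ({ω | r / 5 < ‖∑ i ∈ Finset.range n, Xs i ω - ∑ i ∈ Finset.range n, Xs' i ω‖} ∪
          {ω | ∃ i ∈ Finset.range n, r < ‖Xs i ω‖}) ∪
          {ω | ∃ i ∈ Finset.range n, r < ‖Xs' i ω‖} := by
      intro ω hω
      by_contra hcon
      simp only [Set.mem_union, Set.mem_ofPred_eq, not_or] at hcon hω
      obtain ⟨⟨h1, h2⟩, h3⟩ := hcon
      simp only [ξ] at hω
      rw [← Finset.sum_div, Finset.sum_sub_distrib, hsum _ _ h2, hsum _ _ h3, ← map_sub, abs_div,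
        abs_of_pos (by positivity : 0 < 2 * r), lt_div_iff₀ (by positivity)] at hω
      have := hfle (∑ i ∈ Finset.range n, Xs i ω - ∑ i ∈ Finset.range n, Xs' i ω)
      linarith
    have h1 := measureReal_mono (μ := P) hsub
    have h2 := measureReal_union_le (μ := P)
      ({ω | r / 5 < ‖∑ i ∈ Finset.range n, Xs i ω - ∑ i ∈ Finset.range n, Xs' i ω‖} ∪
          {ω | ∃ i ∈ Finset.range n, r < ‖Xs i ω‖}) {ω | ∃ i ∈ Finset.range n, r < ‖Xs' i ω‖}
    have h3 := measureReal_union_le (μ := P)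
      {ω | r / 5 < ‖∑ i ∈ Finset.range n, Xs i ω - ∑ i ∈ Finset.range n, Xs' i ω‖}
      {ω | ∃ i ∈ Finset.range n, r < ‖Xs i ω‖}
    linarith
  have hsq := hξind.sum_integral_sq_le hξm hξsymm hξb n hsmall
  have hvar : Var[∑ i ∈ Finset.range n, fun ω => g (Xs i ω); P] ≤ 10 * r ^ 2 := by
    have hXind : iIndepFun Xs P := hpair.comp (fun _ p => p.1) fun _ => measurable_fst
    rw [IndepFun.variance_sum (fun i _ => hgL _ (hXs i))
      fun i _ j _ hij => (hXind.indepFun hij).comp hgm hgm]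
    calc ∑ i ∈ Finset.range n, Var[fun ω => g (Xs i ω); P]
        ≤ ∑ i ∈ Finset.range n, (4 * r ^ 2) * ∫ ω, ξ i ω ^ 2 ∂P := by
          refine Finset.sum_le_sum fun i _ => ?_
          refine (variance_le_integral_sub_sq (hgL _ (hXs i)) (hgL _ (hXs' i)) (hgi i)).trans
            (le_of_eq ?_)
          rw [← integral_const_mul]
          congr 1
          ext ω
          simp only [ξ]
          field_simp
          ring
      _ ≤ (4 * r ^ 2) * (5 / 2) := by
          rw [← Finset.mul_sum]; gcongr
      _ = _ := by ring
  have hmean : ∫ ω, (∑ i ∈ Finset.range n, fun ω => g (Xs i ω)) ω ∂P = f m := by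
    simp only [Finset.sum_apply]
    rw [integral_finsetSum _ fun i _ => (hgL _ (hXs i)).integrable (by norm_num),
      Finset.sum_congr rfl fun i _ => show ∫ ω, g (Xs i ω) ∂P = ∫ ω, g (X ω) ∂P from
        ((hid i).comp hgm).integral_eq, hfm]
    simp
  -- Chebyshev: 10 r² / (5r)² = 2/5.
  have hcheb : P.real {ω | 5 * r ≤ |∑ i ∈ Finset.range n, g (Xs i ω) - f m|} ≤ 2 / 5 := by
    have h := meas_ge_le_variance_div_sq (μ := P)
      (memLp_finsetSum' (Finset.range n) fun i _ => hgL _ (hXs i))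
      (by positivity : 0 < 5 * r)
    rw [hmean] at h
    simp only [Finset.sum_apply] at h
    refine ENNReal.toReal_le_of_le_ofReal (by norm_num) (h.trans (ENNReal.ofReal_le_ofReal ?_))
    rw [div_le_iff₀ (by positivity)]
    linarith
  -- The exceptional probabilities add up to at most 1/20 + 1/100 + 2/5 < 1. At a remaining point
  -- the errors `r` and 5r add up to 6r.
  have hne : ∃ ω, ω ∉ ({ω | r < ‖∑ i ∈ Finset.range n, Xs i ω - b‖} ∪
      {ω | ∃ i ∈ Finset.range n, r < ‖Xs i ω‖}) ∪
      {ω | 5 * r ≤ |∑ i ∈ Finset.range n, g (Xs i ω) - f m|} := by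
    by_contra! hall
    have h1 : P.real (({ω | r < ‖∑ i ∈ Finset.range n, Xs i ω - b‖} ∪
      {ω | ∃ i ∈ Finset.range n, r < ‖Xs i ω‖}) ∪
      {ω | 5 * r ≤ |∑ i ∈ Finset.range n, g (Xs i ω) - f m|}) = 1 := by
      rw [Set.eq_univ_of_forall hall, probReal_univ]
    have h2 := measureReal_union_le (μ := P) ({ω | r < ‖∑ i ∈ Finset.range n, Xs i ω - b‖} ∪
      {ω | ∃ i ∈ Finset.range n, r < ‖Xs i ω‖})
      {ω | 5 * r ≤ |∑ i ∈ Finset.range n, g (Xs i ω) - f m|}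
    have h3 := measureReal_union_le (μ := P) {ω | r < ‖∑ i ∈ Finset.range n, Xs i ω - b‖}
      {ω | ∃ i ∈ Finset.range n, r < ‖Xs i ω‖}
    linarith
  obtain ⟨ω, hω⟩ := hne
  simp only [Set.mem_union, Set.mem_ofPred_eq, not_or] at hω
  obtain ⟨⟨h1, h2⟩, h3⟩ := hω
  rw [hsum _ _ h2, not_le] at h3
  rw [not_lt] at h1
  have h4 := hfle (∑ i ∈ Finset.range n, Xs i ω - b)
  rw [map_sub] at h4
  have h5 : ‖b - m‖ = f b - f m := by rw [← map_sub, hfx]; rfl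
  rw [h5]
  linarith [(abs_le.mp (h4.trans h1)).1, (abs_lt.mp h3).2]

end Symmetrization

/-! ### Convergence in probability of normalized sums. -/

section Normalization

variable {Ω : Type*} [MeasurableSpace Ω] {P : Measure Ω} [IsProbabilityMeasure P]
  {B : Type*} [NormedAddCommGroup B]

theorem tendsto_of_tendstoInMeasure_const {c : ℕ → B}
    (h : TendstoInMeasure P (fun n _ => c n) atTop (fun _ => 0)) : Tendsto c atTop (𝓝 0) := by
  rw [tendstoInMeasure_iff_measureReal_norm] at h
  rw [Metric.tendsto_nhds]
  intro ε hε
  filter_upwards [(h ε hε).eventually_lt_const one_pos] with n hn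
  rw [dist_eq_norm]
  by_contra! hcon
  rw [show {ω : Ω | ε ≤ ‖c n - 0‖} = Set.univ from Set.eq_univ_of_forall fun _ => hcon] at hn
  simp at hn

variable [NormedSpace ℝ B]

/-- Clears the denominator, so that tail bounds apply directly at the threshold ε a_n; halving ε
absorbs the change from ≤ to <. -/
theorem tendstoInMeasure_inv_smul_iff {a : ℕ → ℝ} (ha : Tendsto a atTop atTop)
    (Z : ℕ → Ω → B) :
    TendstoInMeasure P (fun n ω => (a n)⁻¹ • Z n ω) atTop (fun _ => 0) ↔
      ∀ ε > 0, Tendsto (fun n => P.real {ω | ε * a n < ‖Z n ω‖}) atTop (𝓝 0) := by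
  have hpos : ∀ᶠ n in atTop, 0 < a n := ha.eventually_gt_atTop 0
  have hnorm : ∀ n ω, 0 < a n → ‖(a n)⁻¹ • Z n ω - 0‖ = ‖Z n ω‖ / a n := by
    intro n ω hn
    rw [sub_zero, norm_smul, norm_inv, Real.norm_of_nonneg hn.le, inv_mul_eq_div]
  rw [tendstoInMeasure_iff_measureReal_norm]
  constructor
  · intro h ε hε
    refine squeeze_zero' (Eventually.of_forall fun _ => measureReal_nonneg) ?_ (h ε hε)
    filter_upwards [hpos] with n hn
    refine measureReal_mono fun ω (hω : ε * a n < ‖Z n ω‖) => ?_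
    change ε ≤ _
    rw [hnorm n ω hn, le_div_iff₀ hn]
    exact hω.le
  · intro h ε hε
    refine squeeze_zero' (Eventually.of_forall fun _ => measureReal_nonneg) ?_
      (h (ε / 2) (half_pos hε))
    filter_upwards [hpos] with n hn
    refine measureReal_mono fun ω hω => ?_
    change ε ≤ _ at hω
    rw [hnorm n ω hn, le_div_iff₀ hn] at hω
    change ε / 2 * a n < _
    nlinarith

theorem TendstoInMeasure.inv_smul_sub {a : ℕ → ℝ} (ha : Tendsto a atTop atTop)
    {Y Z : ℕ → Ω → B}
    (hY : TendstoInMeasure P (fun n ω => (a n)⁻¹ • Y n ω) atTop (fun _ => 0))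
    (hZ : TendstoInMeasure P (fun n ω => (a n)⁻¹ • Z n ω) atTop (fun _ => 0)) :
    TendstoInMeasure P (fun n ω => (a n)⁻¹ • (Y n ω - Z n ω)) atTop (fun _ => 0) := by
  rw [tendstoInMeasure_inv_smul_iff ha] at *
  intro ε hε
  have h := (hY (ε / 2) (half_pos hε)).add (hZ (ε / 2) (half_pos hε))
  rw [add_zero] at h
  refine squeeze_zero (fun _ => measureReal_nonneg) (fun n => ?_) h
  refine le_trans (measureReal_mono ?_) (measureReal_union_le _ _)
  intro ω (hω : ε * a n < _)
  by_contra hcon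
  simp only [Set.mem_union, Set.mem_ofPred_eq, not_or, not_lt] at hcon
  linarith [norm_sub_le (Y n ω) (Z n ω)]

end Normalization

/-! ### The converse in probability. -/

section IndependentCopy

variable {Ω : Type*} [MeasurableSpace Ω] {P : Measure Ω} [IsProbabilityMeasure P]
  {B : Type*} [NormedAddCommGroup B] [NormedSpace ℝ B] [MeasurableSpace B] [BorelSpace B]
  [SecondCountableTopology B]

/-- This makes truncation harmless: the sum controls the tail of X - X', which controls that of `X`
because X / a_n → 0 in probability. -/
theorem tendsto_mul_measureReal_norm_gt {Xs Xs' : ℕ → Ω → B} {X : Ω → B} (hX : Measurable X)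
    (hXs : ∀ i, Measurable (Xs i)) (hXs' : ∀ i, Measurable (Xs' i))
    (hpair : iIndepFun (fun i ω => (Xs i ω, Xs' i ω)) P)
    (hindep : ∀ i, IndepFun (Xs i) (Xs' i) P)
    (hid : ∀ i, IdentDistrib (Xs i) X P P) (hid' : ∀ i, IdentDistrib (Xs' i) X P P)
    {a : ℕ → ℝ} (ha : Tendsto a atTop atTop)
    (h : TendstoInMeasure P (fun (n : ℕ) ω => (a n)⁻¹ • ((∑ i ∈ Finset.range n, Xs i ω)
            - ∑ i ∈ Finset.range n, Xs' i ω)) atTop (fun _ => 0))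
    {η : ℝ} (hη : 0 < η) :
    Tendsto (fun n : ℕ => n * P.real {ω | η * a n < ‖X ω‖}) atTop (𝓝 0) := by
  rw [tendstoInMeasure_inv_smul_iff ha] at h
  -- The 8 is 4 · 2: a factor 4 from sum to term, a factor 2 from X - X' to `X`.
  have hp := h (η / 8) (by positivity)
  have hXa : TendstoInMeasure P (fun n ω => (a n)⁻¹ • X ω) atTop (fun _ => 0) := by
    refine tendstoInMeasure_of_tendsto_ae (fun n => (hX.const_smul _).aestronglyMeasurable)
      (ae_of_all _ fun ω => ?_)
    simpa using (tendsto_inv_atTop_zero.comp ha).smul_const (X ω)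
  rw [tendstoInMeasure_inv_smul_iff ha] at hXa
  have hq := hXa (η / 2) (by positivity)
  -- Again 8 = 4 · 2, the 2 compensating P(‖X‖ ≤ η a_n / 2) ≥ 1/2.
  have hlim := hp.const_mul 8
  rw [mul_zero] at hlim
  refine squeeze_zero' (Eventually.of_forall fun n =>
    mul_nonneg (Nat.cast_nonneg n) measureReal_nonneg) ?_ hlim
  have hDind : iIndepFun (fun i ω => Xs i ω - Xs' i ω) P :=
    hpair.comp (fun _ p => p.1 - p.2) fun _ => by fun_prop
  have hDid : ∀ i, IdentDistrib (fun ω => Xs i ω - Xs' i ω) (fun ω => Xs 0 ω - Xs' 0 ω) P P :=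
    fun i => (IdentDistrib.prodMk ((hid i).trans (hid 0).symm) ((hid' i).trans (hid' 0).symm)
      (hindep i) (hindep 0)).comp (measurable_fst.sub measurable_snd)
  filter_upwards [hp.eventually_le_const (by norm_num : (0 : ℝ) < 1 / 4),
    hq.eventually_le_const (by norm_num : (0 : ℝ) < 1 / 2)] with n hn1 hn2
  have h1 := mul_measureReal_norm_gt_le_of_symmetric hDind (fun i => (hXs i).sub (hXs' i))
    (fun i => identDistrib_sub_neg_sub (hindep i) ((hid' i).trans (hid i).symm)) hDid n
    (η / 8 * a n) (by simpa only [Finset.sum_sub_distrib] using hn1)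
  simp only [Finset.sum_sub_distrib] at h1
  have h2 := measureReal_norm_gt_mul_le_sub (hindep 0) ((hid' 0).trans (hid 0).symm)
    (4 * (η / 8 * a n))
  have e1 : P.real {ω | 2 * (4 * (η / 8 * a n)) < ‖Xs 0 ω‖} = P.real {ω | η * a n < ‖X ω‖} := by
    rw [show 2 * (4 * (η / 8 * a n)) = η * a n by ring]
    exact congrArg ENNReal.toReal ((hid 0).measure_mem_eq (s := {x : B | η * a n < ‖x‖})
      (measurableSet_lt measurable_const (by fun_prop)))
  have e2 : 1 / 2 ≤ P.real {ω | ‖Xs 0 ω‖ ≤ 4 * (η / 8 * a n)} := by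
    rw [show 4 * (η / 8 * a n) = η / 2 * a n by ring,
      show P.real {ω | ‖Xs 0 ω‖ ≤ η / 2 * a n} = P.real {ω | ‖X ω‖ ≤ η / 2 * a n} from
        congrArg ENNReal.toReal ((hid 0).measure_mem_eq (s := {x : B | ‖x‖ ≤ η / 2 * a n})
          (measurableSet_le (by fun_prop) measurable_const))]
    have e3 : {ω | ‖X ω‖ ≤ η / 2 * a n} = {ω | η / 2 * a n < ‖X ω‖}ᶜ := by ext; simp
    rw [e3, probReal_compl_eq_one_sub (measurableSet_lt measurable_const (by fun_prop))]
    linarith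
  rw [e1] at h2
  have h3 : P.real {ω | η * a n < ‖X ω‖} * (1 / 2) ≤
      P.real {ω | 4 * (η / 8 * a n) < ‖Xs 0 ω - Xs' 0 ω‖} :=
    (mul_le_mul_of_nonneg_left e2 measureReal_nonneg).trans h2
  have h4 := mul_le_mul_of_nonneg_left h3 (Nat.cast_nonneg (α := ℝ) n)
  linarith

variable [CompleteSpace B]

/-- Convergence in probability of the normalized symmetrized sums implies that of the sums centred
at their truncated means. -/
theorem tendstoInMeasure_sub_truncated_mean {Xs Xs' : ℕ → Ω → B} {X : Ω → B} (hX : Measurable X)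
    (hXs : ∀ i, Measurable (Xs i)) (hXs' : ∀ i, Measurable (Xs' i))
    (hindep : iIndepFun Xs P) (hindep' : iIndepFun Xs' P)
    (hXX' : IndepFun (fun ω i => Xs i ω) (fun ω i => Xs' i ω) P)
    (hid : ∀ i, IdentDistrib (Xs i) X P P) (hid' : ∀ i, IdentDistrib (Xs' i) X P P)
    {a : ℕ → ℝ} (ha : Tendsto a atTop atTop)
    (h : TendstoInMeasure P (fun (n : ℕ) ω => (a n)⁻¹ • ((∑ i ∈ Finset.range n, Xs i ω)
            - ∑ i ∈ Finset.range n, Xs' i ω)) atTop (fun _ => 0)) :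
    TendstoInMeasure P (fun (n : ℕ) ω => (a n)⁻¹ • ((∑ i ∈ Finset.range n, Xs i ω)
            - (n : ℝ) • ∫ ω', {x | ‖X x‖ ≤ a n}.indicator X ω' ∂P)) atTop (fun _ => 0) := by
  have hpair := hindep.prodMk_of_indepFun hindep' hXs hXs' hXX'
  have hii : ∀ i, IndepFun (Xs i) (Xs' i) P := fun i =>
    hXX'.comp (measurable_pi_apply i) (measurable_pi_apply i)
  have htail := fun {η : ℝ} (hη : 0 < η) =>
    tendsto_mul_measureReal_norm_gt hX hXs hXs' hpair hii hid hid' ha h hη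
  rw [tendstoInMeasure_inv_smul_iff ha] at h ⊢
  intro ε hε
  -- In units of η a_n, the distance from S_n to its centring splits as 1 to `b`, 6 from `b` to the
  -- mean truncated at η a_n, and 1 for changing the truncation level: 8 in all.
  obtain ⟨η, hη0, hη1, hηε⟩ : ∃ η : ℝ, 0 < η ∧ η ≤ 1 ∧ 8 * η ≤ ε :=
    ⟨min 1 (ε / 8), lt_min one_pos (by positivity), min_le_left _ _, by
      linarith [min_le_right 1 (ε / 8)]⟩
  refine squeeze_zero' (Eventually.of_forall fun _ => measureReal_nonneg) ?_
    (h (η / 5) (by positivity))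
  filter_upwards [(h (η / 5) (by positivity)).eventually_le_const
      (by norm_num : (0 : ℝ) < 1 / 20),
    (htail hη0).eventually_le_const (by norm_num : (0 : ℝ) < 1 / 100),
    (htail hη0).eventually_le_const hη0, ha.eventually_gt_atTop 0] with n h1 h2 h3 hapos
  have hr : 0 < η * a n := mul_pos hη0 hapos
  have hle : P.real {ω | η * a n <
      ‖∑ i ∈ Finset.range n, Xs i ω - ∑ i ∈ Finset.range n, Xs' i ω‖} ≤
      P.real {ω | η / 5 * a n <
        ‖∑ i ∈ Finset.range n, Xs i ω - ∑ i ∈ Finset.range n, Xs' i ω‖} := by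
    refine measureReal_mono fun ω (hω : η * a n < _) => ?_
    change η / 5 * a n < _
    linarith
  obtain ⟨b, hb⟩ : ∃ b, P.real {ω | η * a n < ‖∑ i ∈ Finset.range n, Xs i ω - b‖} ≤
      P.real {ω | η * a n <
        ‖∑ i ∈ Finset.range n, Xs i ω - ∑ i ∈ Finset.range n, Xs' i ω‖} := by
    obtain ⟨b, hb⟩ := exists_measure_section_le (P := P)
      (U := fun ω => ∑ i ∈ Finset.range n, Xs i ω) (V := fun ω => ∑ i ∈ Finset.range n, Xs' i ω)
      (by fun_prop) (by fun_prop)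
      (hXX'.comp (φ := fun x : ℕ → B => ∑ i ∈ Finset.range n, x i)
        (ψ := fun x : ℕ → B => ∑ i ∈ Finset.range n, x i) (by fun_prop) (by fun_prop))
      (s := {p : B × B | η * a n < ‖p.1 - p.2‖})
      (measurableSet_lt measurable_const (by fun_prop))
    exact ⟨b, ENNReal.toReal_mono (measure_ne_top _ _) hb⟩
  have hmean := norm_sub_smul_truncated_mean_le hX hXs hXs' hpair hii hid hid' hr n b
    (by rw [mul_div_right_comm]; exact h1) h2 (hb.trans (hle.trans h1))
  have htrunc := norm_integral_indicator_sub_le (P := P) hX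
    (by nlinarith : η * a n ≤ a n) hapos.le
  refine le_trans (measureReal_mono ?_) (hb.trans hle)
  intro ω (hω : ε * a n < _)
  change η * a n < _
  have e1 : ‖(n : ℝ) • (∫ ω, {x | ‖X x‖ ≤ η * a n}.indicator X ω ∂P) -
      (n : ℝ) • ∫ ω, {x | ‖X x‖ ≤ a n}.indicator X ω ∂P‖ ≤ η * a n := by
    rw [← smul_sub, norm_smul, Real.norm_of_nonneg (Nat.cast_nonneg n)]
    have := mul_le_mul_of_nonneg_left htrunc (Nat.cast_nonneg (α := ℝ) n)
    nlinarith
  have e2 := norm_sub_le_norm_sub_add_norm_sub (∑ i ∈ Finset.range n, Xs i ω) b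
    ((n : ℝ) • ∫ ω, {x | ‖X x‖ ≤ a n}.indicator X ω ∂P)
  have e3 := norm_sub_le_norm_sub_add_norm_sub b
    ((n : ℝ) • ∫ ω, {x | ‖X x‖ ≤ η * a n}.indicator X ω ∂P)
    ((n : ℝ) • ∫ ω, {x | ‖X x‖ ≤ a n}.indicator X ω ∂P)
  nlinarith

end IndependentCopy

/-! ### The two equivalences. -/

theorem corollary3p2
    {Ω : Type*} [MeasurableSpace Ω] (P : Measure Ω) [IsProbabilityMeasure P]
    {B : Type*} [NormedAddCommGroup B] [NormedSpace ℝ B] [CompleteSpace B]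
    [TopologicalSpace.SeparableSpace B] [MeasurableSpace B] [BorelSpace B]
    -- `Xs i` and `Xs' i` are the variables with index `i + 1` (counting from 1); `X` is the generic one
    (X : Ω → B) (Xs Xs' : ℕ → Ω → B)
    (hX : Measurable X) (hXs : ∀ i, Measurable (Xs i)) (hXs' : ∀ i, Measurable (Xs' i))
    -- the sequence is i.i.d. with the law of `X`
    (hindep : iIndepFun Xs P) (hident : ∀ i, IdentDistrib (Xs i) X P P)
    -- the second sequence is an independent copy of the first one (as a whole sequence)
    (hcopy : IdentDistrib (fun ω i => Xs' i ω) (fun ω i => Xs i ω) P P)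
    (hcopy_indep : IndepFun (fun ω i => Xs i ω) (fun ω i => Xs' i ω) P)
    -- the norming sequence is indexed by `n ≥ 1`
    (a : ℕ → ℝ) (ha_pos : ∀ n, 1 ≤ n → 0 < a n) (ha_mono : MonotoneOn a (Set.Ici 1))
    (ha_lim : Tendsto a atTop atTop) :
    ((∀ᵐ ω ∂P, Tendsto
          (fun n : ℕ => (a n)⁻¹ • ((∑ i ∈ Finset.range n, Xs i ω)
            - (n : ℝ) • ∫ ω', {x | ‖X x‖ ≤ a n}.indicator X ω' ∂P)) atTop (𝓝 0))
      ↔ (∀ᵐ ω ∂P, Tendsto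
          (fun n : ℕ => (a n)⁻¹ • ((∑ i ∈ Finset.range n, Xs i ω)
            - ∑ i ∈ Finset.range n, Xs' i ω)) atTop (𝓝 0)))
    ∧ (TendstoInMeasure P
          (fun (n : ℕ) ω => (a n)⁻¹ • ((∑ i ∈ Finset.range n, Xs i ω)
            - (n : ℝ) • ∫ ω', {x | ‖X x‖ ≤ a n}.indicator X ω' ∂P)) atTop (fun _ => 0)
      ↔ TendstoInMeasure P
          (fun (n : ℕ) ω => (a n)⁻¹ • ((∑ i ∈ Finset.range n, Xs i ω)
            - ∑ i ∈ Finset.range n, Xs' i ω)) atTop (fun _ => 0)) := by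
  have : SecondCountableTopology B := UniformSpace.secondCountable_of_separable B
  have hindep' : iIndepFun Xs' P := hcopy.iIndepFun_of_process hindep hXs hXs'
  have hident' : ∀ i, IdentDistrib (Xs' i) X P P := fun i =>
    (hcopy.comp (measurable_pi_apply i)).trans (hident i)
  have hXp : Measurable fun ω i => Xs i ω := measurable_pi_lambda _ hXs
  have hXp' : Measurable fun ω i => Xs' i ω := measurable_pi_lambda _ hXs'
  set m : ℕ → B := fun n => (n : ℝ) • ∫ ω', {x | ‖X x‖ ≤ a n}.indicator X ω' ∂P with hm
  have hback := tendstoInMeasure_sub_truncated_mean hX hXs hXs' hindep hindep' hcopy_indep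
    hident hident' ha_lim
  refine ⟨⟨fun h => ?_, fun h => ?_⟩, fun h => ?_, hback⟩
  · have hC : MeasurableSet {x : ℕ → B | Tendsto
        (fun n : ℕ => (a n)⁻¹ • ((∑ i ∈ Finset.range n, x i) - m n)) atTop (𝓝 0)} :=
      measurableSet_tendsto _ fun n => by fun_prop
    -- Convergence is an event on path space, so it transfers to the copy.
    have h' := hcopy.symm.ae_snd hC h
    filter_upwards [h, h'] with ω h1 h2
    have h3 := h1.sub h2
    rw [sub_zero] at h3
    refine h3.congr fun n => ?_
    rw [← smul_sub, sub_sub_sub_cancel_right]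
  · have hC : MeasurableSet {p : (ℕ → B) × (ℕ → B) | Tendsto (fun n : ℕ => (a n)⁻¹ •
        ((∑ i ∈ Finset.range n, p.1 i) - ∑ i ∈ Finset.range n, p.2 i)) atTop (𝓝 0)}ᶜ :=
      (measurableSet_tendsto _ fun n => by fun_prop).compl
    -- The divergence set is null, so its section at some fixed path `y` is null too.
    obtain ⟨y, hy⟩ := exists_measure_section_le hXp hXp' hcopy_indep hC
    have hy' : ∀ᵐ ω ∂P, Tendsto (fun n : ℕ => (a n)⁻¹ •
        ((∑ i ∈ Finset.range n, Xs i ω) - ∑ i ∈ Finset.range n, y i)) atTop (𝓝 0) :=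
      le_antisymm (hy.trans (le_of_eq h)) zero_le
    have hprob := hback <| tendstoInMeasure_of_tendsto_ae
      (fun n => Measurable.aestronglyMeasurable (by fun_prop)) h
    have hprob' : TendstoInMeasure P (fun (n : ℕ) ω => (a n)⁻¹ •
        ((∑ i ∈ Finset.range n, Xs i ω) - ∑ i ∈ Finset.range n, y i)) atTop (fun _ => 0) :=
      tendstoInMeasure_of_tendsto_ae (fun n => Measurable.aestronglyMeasurable (by fun_prop)) hy'
    -- The random sums cancel, leaving the difference of two deterministic centrings.
    have hdet := TendstoInMeasure.inv_smul_sub ha_lim hprob hprob'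
    simp only [sub_sub_sub_cancel_left] at hdet
    have hdet' := tendsto_of_tendstoInMeasure_const hdet
    filter_upwards [hy'] with ω hω
    have h3 := hω.add hdet'
    rw [add_zero] at h3
    refine h3.congr fun n => ?_
    rw [← smul_add, sub_add_sub_cancel]
  · have h' : TendstoInMeasure P (fun (n : ℕ) ω => (a n)⁻¹ •
        ((∑ i ∈ Finset.range n, Xs' i ω) - m n)) atTop (fun _ => 0) := by
      rw [tendstoInMeasure_inv_smul_iff ha_lim] at h ⊢
      intro ε hε
      refine (h ε hε).congr fun n => ?_
      exact congrArg ENNReal.toReal (hcopy.symm.measure_mem_eq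
        (s := {x : ℕ → B | ε * a n < ‖(∑ i ∈ Finset.range n, x i) - m n‖})
        (measurableSet_lt measurable_const (by fun_prop)))
    have hsub := TendstoInMeasure.inv_smul_sub ha_lim h h'
    simpa only [hm, sub_sub_sub_cancel_right] using hsub
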